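/- A full-dimensional polytope $P\subset\mathbb{R}^n$ (an $n$-polytope) is the convex hull of a finite set of points, with nonempty interior. Let $p_1,\dots,p_v$ be its vertices and let $P=\{x\in\mathbb{R}^n : h_1(x)\ge 0,\dots,h_f(x)\ge 0\}$ be an irredundant representation by affine inequalities, so that the facets of $P$ are $F_j=\{x\in P: h_j(x)=0\}$. The slack matrix of $P$ is the $v\times f$ matrix with entries $h_j(p_i)$, and its symbolic slack matrix $S_P(x)$ is obtained from it by replacing the positive entries by distinct variables $x_1,\dots,x_t$. Two polytopes are combinatorially equivalent if they have the same vertex-facet incidence structure up to relabelling. A trinomial is a polynomial $\pm x^a\pm x^b\pm x^c$ with pairwise distinct exponents $a,b,c\in\mathbb{N}^t$. The psd rank of a convex set $C\subset\mathbb{R}^n$ is the smallest positive integer $k$ such that $C=\pi(\mathcal{S}^k_+\cap L)$ for some affine subspace $L$ of the space of $k\times k$ matrices and some linear map $\pi$ from it to $\mathbb{R}^n$, where $\mathcal{S}^k_+$ is the cone of real symmetric positive semidefinite $k\times k$ matrices; it is $\infty$ if there is no such $k$. A full-dimensional polytope in $\mathbb{R}^m$ is psd-minimal if its psd rank equals $m+1$.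 **Lemma (Trinomial Obstruction Lemma).** Let $P$ be an $n$-polytope whose symbolic slack matrix $S_P(x)$ has an $(n+2)$-minor that is a trinomial. Then no polytope combinatorially equivalent to $P$ is psd-minimal. -/

import Mathlib

/-- A full-dimensional polytope in `ℝⁿ` (the convex hull of a finite set, with nonempty interior),
given together with an irredundant inequality representation
`P = {x | h 0 x ≥ 0, …, h (f - 1) x ≥ 0}`: dropping any one of the inequalities changes the set.
For a full-dimensional polytope the inequalities `h j` of such a representation correspond
bijectively to the facets `{x ∈ P | h j x = 0}`, and each `h j` is unique up to a positive
factor. -/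
structure FullDimPolytope (n : ℕ) where
  /-- the underlying set of points -/
  carrier : Set (EuclideanSpace ℝ (Fin n))
  /-- the number of facets -/
  f : ℕ
  /-- the affine functions of the facet inequalities -/
  h : Fin f → (EuclideanSpace ℝ (Fin n) →ᵃ[ℝ] ℝ)
  exists_hull : ∃ s : Finset (EuclideanSpace ℝ (Fin n)), carrier = convexHull ℝ (s : Set _)
  fullDim : (interior carrier).Nonempty
  carrier_eq : carrier = {x | ∀ j, 0 ≤ h j x}
  irredundant : ∀ j, carrier ≠ {x | ∀ i, i ≠ j → 0 ≤ h i x}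

namespace FullDimPolytope

/-- The set of vertices. -/
def vertices {n : ℕ} (P : FullDimPolytope n) : Set (EuclideanSpace ℝ (Fin n)) :=
  P.carrier.extremePoints ℝ

/-- The `j`-th facet. -/
def facet {n : ℕ} (P : FullDimPolytope n) (j : Fin P.f) : Set (EuclideanSpace ℝ (Fin n)) :=
  {x ∈ P.carrier | P.h j x = 0}

/-- The slack matrix, with rows indexed by the vertices and columns indexed by the facets. -/
noncomputable def slackMatrix {n : ℕ} (P : FullDimPolytope n) : Matrix P.vertices (Fin P.f) ℝ :=
  fun p j => P.h j p

open Classical in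
/-- The symbolic slack matrix: each positive entry of the slack matrix is replaced by a variable of
its own (the one named by the position of the entry); the other entries are zero and stay zero. -/
noncomputable def symbolicSlackMatrix {n : ℕ} (P : FullDimPolytope n) :
    Matrix P.vertices (Fin P.f) (MvPolynomial (P.vertices × Fin P.f) ℝ) :=
  fun p j => if 0 < P.slackMatrix p j then MvPolynomial.X (p, j) else 0

/-- Combinatorial equivalence: the vertex-facet incidence structures are isomorphic. -/
def CombEquiv {n m : ℕ} (P : FullDimPolytope n) (Q : FullDimPolytope m) : Prop :=
  ∃ (φ : P.vertices ≃ Q.vertices) (ψ : Fin P.f ≃ Fin Q.f),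
    ∀ (p : P.vertices) (j : Fin P.f), (p : EuclideanSpace ℝ (Fin n)) ∈ P.facet j ↔
      (φ p : EuclideanSpace ℝ (Fin m)) ∈ Q.facet (ψ j)

end FullDimPolytope

/-- `C` is a linear image of an affine slice of the cone of real symmetric positive semidefinite
`k × k` matrices. -/
def HasPsdLift {n : ℕ} (C : Set (EuclideanSpace ℝ (Fin n))) (k : ℕ) : Prop :=
  ∃ (L : AffineSubspace ℝ (Matrix (Fin k) (Fin k) ℝ))
    (π : Matrix (Fin k) (Fin k) ℝ →ₗ[ℝ] EuclideanSpace ℝ (Fin n)),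
    C = π '' ({X | X.PosSemidef} ∩ (L : Set (Matrix (Fin k) (Fin k) ℝ)))

/-- The psd rank of `C`: the least positive `k` for which `C` has a psd lift of size `k`, and `⊤` if
there is none. -/
noncomputable def psdRank {n : ℕ} (C : Set (EuclideanSpace ℝ (Fin n))) : ℕ∞ :=
  ⨅ k ∈ {k : ℕ | 0 < k ∧ HasPsdLift C k}, (k : ℕ∞)

/-- A full-dimensional polytope in `ℝⁿ` is psd-minimal if its psd rank is `n + 1`. -/
def FullDimPolytope.PsdMinimal {n : ℕ} (P : FullDimPolytope n) : Prop :=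
  psdRank P.carrier = (n : ℕ∞) + 1

/-- A trinomial: `± x^a ± x^b ± x^c` with pairwise distinct exponents `a, b, c`. -/
def IsTrinomial {σ : Type*} (p : MvPolynomial σ ℝ) : Prop :=
  ∃ (a b c : σ →₀ ℕ) (α β γ : ℝ),
    a ≠ b ∧ a ≠ c ∧ b ≠ c ∧
    (α = 1 ∨ α = -1) ∧ (β = 1 ∨ β = -1) ∧ (γ = 1 ∨ γ = -1) ∧
    p = MvPolynomial.monomial a α + MvPolynomial.monomial b β + MvPolynomial.monomial c γ

/-- `d` is a `k`-minor of `M`: the determinant of a submatrix given by `k` distinct rows and `k`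
distinct columns (listed in any order, so that `d` is determined up to sign). -/
def IsMinor {ι κ R : Type*} [CommRing R] (M : Matrix ι κ R) (k : ℕ) (d : R) : Prop :=
  ∃ (r : Fin k ↪ ι) (c : Fin k ↪ κ), d = (M.submatrix r c).det

/-! ### Flags of faces of a polyhedron. -/

section Flags

variable {V ι : Type*} [AddCommGroup V] [Module ℝ V]

/-! Suppose `Q` is psd-minimal of dimension `m` and combinatorially equivalent to `P`. Its slack
matrix has rank at most `m + 1`, and so does some entrywise square root of it
(`exists_hadamard_sqrt`). Both have the support of the slack matrix of `P`, and `m ≤ n`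
(`CombEquiv.dim_le`), so every `(n + 2)`-minor of the symbolic matrix vanishes at the entries of the
root and at their squares. For a trinomial this gives nonzero reals with `±A ± B ± C = 0` and, with
the same signs, `±A² ± B² ± C² = 0`, which is impossible.

The root comes from a lift of size `m + 1`. Along a complete flag of faces the kernels of generic
lifted points grow strictly. Hence a matrix over a vertex has kernel of dimension at least `m`, so
it is `a aᵀ`, while a generic point over a facet has a kernel spanned by one vector `b`. A facet
function is nonnegative on the slice and zero at that point, so it is a multiple of `A ↦ bᵀ A b`.
Its value at the vertex is thus a multiple of `(b ⬝ᵥ a)²`. -/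

theorem AffineMap.apply_add_smul_sub (g : V →ᵃ[ℝ] ℝ) (x y : V) (t : ℝ) :
    g (x + t • (y - x)) = g x + t * (g y - g x) := by
  have h1 := g.map_vadd x (t • (y - x))
  have h2 := g.linearMap_vsub y x
  simp only [vsub_eq_sub, vadd_eq_add] at h1 h2
  rw [add_comm, h1, map_smul, h2, smul_eq_mul, add_comm]

/-- `z` lies in the relative interior of the face of `{x | ∀ i, 0 ≤ h i x}` cut out by the affine
subspace `z + W`, and within this subspace the inequalities indexed by `J` suffice. -/
structure IsFaceFrame (h : ι → V →ᵃ[ℝ] ℝ) (W : Submodule ℝ V) (J : Finset ι) (z : V) : Prop where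
  pos : ∀ i ∈ J, 0 < h i z
  suff : ∀ x, x - z ∈ W → (∀ i ∈ J, 0 ≤ h i x) → ∀ i, 0 ≤ h i x

/-- A descending sequence of points of the polyhedron `{x | ∀ i, 0 ≤ h i x}`: the `k`-th point
satisfies the inequalities `j 0, …, j (k - 1)` with equality and the inequality `j k` strictly. -/
structure IsFlag (h : ι → V →ᵃ[ℝ] ℝ) (d : ℕ) (y : ℕ → V) (j : ℕ → ι) : Prop where
  nonneg : ∀ k ≤ d, ∀ i, 0 ≤ h i (y k)
  pos : ∀ k < d, 0 < h (j k) (y k)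
  zero : ∀ i k, i < k → k ≤ d → h (j i) (y k) = 0

theorem IsFlag.tail {h : ι → V →ᵃ[ℝ] ℝ} {d : ℕ} {y : ℕ → V} {j : ℕ → ι}
    (H : IsFlag h (d + 1) y j) : IsFlag h d (fun k => y (k + 1)) (fun k => j (k + 1)) where
  nonneg k hk := H.nonneg (k + 1) (by omega)
  pos k hk := H.pos (k + 1) (by omega)
  zero i k hik hk := H.zero (i + 1) (k + 1) (by omega) (by omega)

theorem IsFlag.cons {h : ι → V →ᵃ[ℝ] ℝ} {d : ℕ} {y : ℕ → V} {j : ℕ → ι}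
    (H : IsFlag h d y j) {z : V} {i : ι} (hz : ∀ i, 0 ≤ h i z) (hi : 0 < h i z)
    (hy : ∀ k ≤ d, h i (y k) = 0) :
    IsFlag h (d + 1) (fun k => k.casesOn z y) (fun k => k.casesOn i j) where
  nonneg
    | 0, _ => hz
    | k + 1, hk => H.nonneg k (by omega)
  pos
    | 0, _ => hi
    | k + 1, hk => H.pos k (by omega)
  zero
    | _, 0, hik, _ => absurd hik (by omega)
    | 0, k + 1, _, hk => hy k (by omega)
    | i + 1, k + 1, hik, hk => H.zero i k (by omega) (by omega)

theorem IsFaceFrame.nonneg {h : ι → V →ᵃ[ℝ] ℝ} {W : Submodule ℝ V} {J : Finset ι} {z : V}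
    (H : IsFaceFrame h W J z) (i : ι) : 0 ≤ h i z :=
  H.suff z (by simp) (fun i hi => (H.pos i hi).le) i

-- Passing to a facet can make inherited inequalities redundant; discarding them lets `step` descend
-- again along any remaining one.
open Classical in
theorem IsFaceFrame.exists_minimal {h : ι → V →ᵃ[ℝ] ℝ} {W : Submodule ℝ V} {J : Finset ι} {z : V}
    (H : IsFaceFrame h W J z) :
    ∃ J', IsFaceFrame h W J' z ∧ ∀ j ∈ J', ¬ IsFaceFrame h W (J'.erase j) z := by
  induction J using Finset.strongInduction with
  | H J ih =>
    by_cases hJ : ∃ j ∈ J, IsFaceFrame h W (J.erase j) z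
    · obtain ⟨j, hj, hJ⟩ := hJ
      exact ih _ (Finset.erase_ssubset hj) hJ
    · push Not at hJ
      exact ⟨J, H, hJ⟩

-- Some point of `z + W` violates the inequality `j` and no other in `J`. The segment from `z` to it
-- meets `h j = 0` where the rest of `J` is still strict.
open Classical in
theorem IsFaceFrame.step [FiniteDimensional ℝ V] {h : ι → V →ᵃ[ℝ] ℝ} {W : Submodule ℝ V}
    {J : Finset ι} {z : V} (H : IsFaceFrame h W J z) {j : ι} (hj : j ∈ J)
    (hJ : ¬ IsFaceFrame h W (J.erase j) z) :
    ∃ z', z' - z ∈ W ∧ h j z' = 0 ∧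
      IsFaceFrame h (W ⊓ LinearMap.ker (h j).linear) (J.erase j) z' ∧
      Module.finrank ℝ W = Module.finrank ℝ ↥(W ⊓ LinearMap.ker (h j).linear) + 1 := by
  have : ∃ y, y - z ∈ W ∧ (∀ i ∈ J.erase j, 0 ≤ h i y) ∧ h j y < 0 := by
    by_contra! hcon
    refine hJ ⟨fun i hi => H.pos i (Finset.mem_of_mem_erase hi), fun x hx hx' =>
      H.suff x hx fun i hi => ?_⟩
    by_cases hij : i = j
    · exact hij ▸ hcon x hx hx'
    · exact hx' i (Finset.mem_erase.2 ⟨hij, hi⟩)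
  obtain ⟨y, hyW, hy, hjy⟩ := this
  have hjz := H.pos j hj
  set t : ℝ := h j z / (h j z - h j y) with ht
  have hden : 0 < h j z - h j y := by linarith
  have ht0 : 0 < t := div_pos hjz hden
  have ht1 : t < 1 := (div_lt_one hden).2 (by linarith)
  have hz'W : z + t • (y - z) - z ∈ W := by
    rw [add_sub_cancel_left]; exact W.smul_mem _ hyW
  have hz'j : h j (z + t • (y - z)) = 0 := by
    rw [AffineMap.apply_add_smul_sub, ht]; field_simp; ring
  refine ⟨z + t • (y - z), hz'W, hz'j, ⟨fun i hi => ?_, fun x hx hx' => H.suff x ?_ fun i hi => ?_⟩,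
    ?_⟩
  · rw [AffineMap.apply_add_smul_sub]
    have h1 := H.pos i (Finset.mem_of_mem_erase hi)
    have h2 := hy i hi
    nlinarith
  · have := W.add_mem hx.1 hz'W
    rwa [sub_add_sub_cancel] at this
  · by_cases hij : i = j
    · subst hij
      have h1 := (h i).linearMap_vsub x (z + t • (y - z))
      have h2 : (h i).linear (x - (z + t • (y - z))) = 0 := hx.2
      rw [vsub_eq_sub, h2, hz'j, vsub_eq_sub] at h1
      linarith
    · exact hx' i (Finset.mem_erase.2 ⟨hij, hi⟩)
  · set g : W →ₗ[ℝ] ℝ := (h j).linear.domRestrict W with hg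
    have hne : g ⟨y - z, hyW⟩ ≠ 0 := by
      have := (h j).linearMap_vsub y z
      rw [vsub_eq_sub, vsub_eq_sub] at this
      rw [hg, LinearMap.domRestrict_apply, this]
      linarith
    have h1 := LinearMap.finrank_range_add_finrank_ker g
    have h2 : LinearMap.range g = ⊤ :=
      LinearMap.range_eq_top.2 (LinearMap.surjective (fun h0 => hne (by rw [h0]; rfl)))
    have h3 : Module.finrank ℝ (LinearMap.ker g) =
        Module.finrank ℝ ↥(W ⊓ LinearMap.ker (h j).linear) := by
      have : LinearMap.ker g = (LinearMap.ker (h j).linear).comap W.subtype := by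
        ext w; rfl
      rw [this, ← Submodule.map_comap_subtype]
      exact (LinearEquiv.finrank_eq (Submodule.equivMapOfInjective _ W.injective_subtype _))
    rw [h2, finrank_top, Module.finrank_self, h3] at h1
    omega

/-- An extreme point of a face of positive dimension satisfies with equality one of the inequalities
that describe the face. -/
theorem IsFaceFrame.exists_eq_zero {h : ι → V →ᵃ[ℝ] ℝ} {W : Submodule ℝ V}
    {J : Finset ι} {z p : V} (H : IsFaceFrame h W J z) (hW : W ≠ ⊥)
    (hp : p ∈ {x | ∀ i, 0 ≤ h i x}.extremePoints ℝ) (hpz : p - z ∈ W) :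
    ∃ j ∈ J, h j p = 0 := by
  by_contra! hcon
  have hpos : ∀ j ∈ J, 0 < h j p := fun j hj => lt_of_le_of_ne (hp.1 j) (hcon j hj).symm
  obtain ⟨w, hw, hw0⟩ := W.exists_mem_ne_zero_of_ne_bot hW
  -- If no inequality in `J` is tight at `p`, both `p + ε • w` and `p - ε • w` are feasible, so `p`
  -- is the midpoint of a segment.
  have hev : ∃ ε : ℝ, 0 < ε ∧ ∀ j ∈ J, ε * |(h j).linear w| ≤ h j p := by
    clear hcon H
    classical
    induction J using Finset.induction_on with
    | empty => exact ⟨1, one_pos, by simp⟩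
    | insert a s ha ih =>
      obtain ⟨ε, hε, h1⟩ := ih fun j hj => hpos j (Finset.mem_insert_of_mem hj)
      have ha := hpos a (Finset.mem_insert_self a s)
      have hd : 0 < |(h a).linear w| + 1 := by positivity
      refine ⟨min ε (h a p / (|(h a).linear w| + 1)), lt_min hε (by positivity), fun j hj => ?_⟩
      rcases Finset.mem_insert.1 hj with rfl | hj
      · calc _ ≤ h j p / (|(h j).linear w| + 1) * |(h j).linear w| := by
              gcongr; exact min_le_right _ _
          _ ≤ h j p / (|(h j).linear w| + 1) * (|(h j).linear w| + 1) := by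
              gcongr; linarith
          _ = h j p := div_mul_cancel₀ _ hd.ne'
      · refine le_trans ?_ (h1 j hj)
        gcongr; exact min_le_left _ _
  obtain ⟨ε, hε, hεJ⟩ := hev
  have key : ∀ s : ℝ, |s| = ε → p + s • w ∈ {x | ∀ i, 0 ≤ h i x} := by
    intro s hs
    refine H.suff _ ?_ fun i hi => ?_
    · rw [add_sub_right_comm]; exact W.add_mem hpz (W.smul_mem _ hw)
    · have h1 := (h i).map_vadd p (s • w)
      rw [vadd_eq_add, vadd_eq_add, map_smul, smul_eq_mul, add_comm] at h1
      have h2 := hεJ i hi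
      rw [← hs, ← abs_mul] at h2
      rw [h1]
      linarith [neg_abs_le (s * (h i).linear w)]
  have h1 := key ε (abs_of_pos hε)
  have h2 := key (-ε) (by rw [abs_neg, abs_of_pos hε])
  have := hp.2 h1 h2 ⟨1 / 2, 1 / 2, by norm_num, by norm_num, by norm_num, by module⟩
  have h3 : ε • w = 0 := by simpa using this
  exact hw0 ((smul_eq_zero.1 h3).resolve_left hε.ne')

theorem IsFaceFrame.exists_flag [FiniteDimensional ℝ V] [Nonempty ι] {h : ι → V →ᵃ[ℝ] ℝ} {p : V}
    (hp : p ∈ {x | ∀ i, 0 ≤ h i x}.extremePoints ℝ) (d : ℕ) :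
    ∀ {W : Submodule ℝ V} {J : Finset ι} {z : V}, IsFaceFrame h W J z → p - z ∈ W →
      Module.finrank ℝ W = d →
      ∃ y j, IsFlag h d y j ∧ y d = p ∧ ∀ k ≤ d, y k - z ∈ W := by
  induction d with
  | zero =>
    intro W J z H hpz hd
    have : p - z = 0 := by
      rw [Submodule.finrank_eq_zero.1 hd] at hpz; simpa using hpz
    -- A flag of length zero uses no index, so any default serves.
    refine ⟨fun _ => p, fun _ => Classical.arbitrary ι, ⟨fun _ _ => hp.1, by simp, ?_⟩, rfl,
      fun _ _ => hpz⟩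
    intro i k; omega
  | succ d ih =>
    intro W J z H hpz hd
    classical
    obtain ⟨J, H, hmin⟩ := H.exists_minimal
    obtain ⟨j, hj, hjp⟩ := H.exists_eq_zero (by rintro rfl; simp at hd) hp hpz
    obtain ⟨z', hz'W, hz'j, H', hrank⟩ := H.step hj (hmin j hj)
    have hlin : ∀ x, x - z' ∈ LinearMap.ker (h j).linear ↔ h j x = 0 := by
      intro x
      have := (h j).linearMap_vsub x z'
      rw [vsub_eq_sub, hz'j, vsub_eq_sub, sub_zero] at this
      rw [LinearMap.mem_ker, this]
    have hpz' : p - z' ∈ W := by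
      have := W.sub_mem hpz hz'W
      rwa [sub_sub_sub_cancel_right] at this
    obtain ⟨y, i, hflag, hyp, hyW⟩ := ih H' ⟨hpz', (hlin p).2 hjp⟩ (by omega)
    refine ⟨_, _, hflag.cons H.nonneg (H.pos j hj) fun k hk => (hlin _).1 (hyW k hk).2, hyp, ?_⟩
    rintro (_ | k) hk
    · simp
    · have := W.add_mem (hyW k (by omega)).1 hz'W
      rwa [sub_add_sub_cancel] at this

end Flags

/-! ### Vertices, facets and flags of a polytope. -/

section Polytope

variable {m : ℕ} (Q : FullDimPolytope m)

namespace FullDimPolytope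

/-- Irredundancy gives a point violating only the inequality `j`. Were `h j` zero at an interior
`z`, a small move towards that point would leave the polytope. -/
theorem exists_isFaceFrame : ∃ z, IsFaceFrame Q.h ⊤ Finset.univ z ∧
    ∀ j, ¬ IsFaceFrame Q.h ⊤ (Finset.univ.erase j) z := by
  obtain ⟨z, hz⟩ := Q.fullDim
  have hirr : ∀ j, ∃ y, (∀ i, i ≠ j → 0 ≤ Q.h i y) ∧ Q.h j y < 0 := by
    intro j
    by_contra! hcon
    refine Q.irredundant j (Set.ext fun x => ?_)
    rw [Q.carrier_eq]
    refine ⟨fun hx i _ => hx i, fun hx i => ?_⟩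
    by_cases hij : i = j
    · exact hij ▸ hcon x hx
    · exact hx i hij
  refine ⟨z, ⟨fun j _ => ?_, fun x _ hx i => hx i (Finset.mem_univ i)⟩, fun j hj => ?_⟩
  · obtain ⟨y, -, hy⟩ := hirr j
    have hcont : Filter.Tendsto (fun t : ℝ => z + t • (y - z)) (nhdsWithin 0 (Set.Ioi 0))
        (nhds z) := by
      have : Continuous fun t : ℝ => z + t • (y - z) := by fun_prop
      have h0 := this.tendsto 0
      simp only [zero_smul, add_zero] at h0
      exact h0.mono_left nhdsWithin_le_nhds
    have h1 := hcont.eventually (mem_interior_iff_mem_nhds.1 hz)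
    have h2 : ∀ᶠ t : ℝ in nhdsWithin 0 (Set.Ioi 0), t ∈ Set.Ioo (0 : ℝ) 1 :=
      Ioo_mem_nhdsGT one_pos
    obtain ⟨t, ht, ht0, ht1⟩ := (h1.and h2).exists
    have ht : z + t • (y - z) ∈ Q.carrier := ht
    rw [Q.carrier_eq] at ht
    have h3 := ht j
    rw [AffineMap.apply_add_smul_sub] at h3
    nlinarith
  · obtain ⟨y, hy, hy'⟩ := hirr j
    exact absurd (hj.suff y trivial (fun i hi => hy i (Finset.ne_of_mem_erase hi)) j)
      (not_le.2 hy')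

theorem vertex_nonneg (p : Q.vertices) (j : Fin Q.f) : 0 ≤ Q.h j p := by
  have := p.2.1
  rw [Q.carrier_eq] at this
  exact this j

theorem mem_facet_iff (p : Q.vertices) (j : Fin Q.f) :
    (p : EuclideanSpace ℝ (Fin m)) ∈ Q.facet j ↔ Q.h j p = 0 :=
  ⟨fun h => h.2, fun h => ⟨p.2.1, h⟩⟩

theorem exists_facet_of_vertex [NeZero m] (p : Q.vertices) : ∃ j, Q.h j p = 0 := by
  obtain ⟨z, hz, -⟩ := Q.exists_isFaceFrame
  have hp := p.2
  change (p : EuclideanSpace ℝ (Fin m)) ∈ Q.carrier.extremePoints ℝ at hp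
  rw [Q.carrier_eq] at hp
  have : Nontrivial (EuclideanSpace ℝ (Fin m)) := by
    have : Nonempty (Fin m) := ⟨0⟩
    infer_instance
  obtain ⟨j, -, hj⟩ := hz.exists_eq_zero top_ne_bot hp trivial
  exact ⟨j, hj⟩

/-- A vertex and a facet through it are the ends of a flag of full length. -/
theorem exists_flag {d : ℕ} (hd : m = d + 1) (p : Q.vertices) {j₀ : Fin Q.f}
    (hp : Q.h j₀ p = 0) :
    ∃ y j, IsFlag Q.h (d + 1) y j ∧ j 0 = j₀ ∧ y (d + 1) = p := by
  obtain ⟨z, hz, hirr⟩ := Q.exists_isFaceFrame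
  obtain ⟨z', hz'W, hz'j, H', hrank⟩ := hz.step (Finset.mem_univ j₀) (by convert hirr j₀)
  have hlin : ∀ x, x - z' ∈ LinearMap.ker (Q.h j₀).linear ↔ Q.h j₀ x = 0 := by
    intro x
    have := (Q.h j₀).linearMap_vsub x z'
    rw [vsub_eq_sub, hz'j, vsub_eq_sub, sub_zero] at this
    rw [LinearMap.mem_ker, this]
  have hpe := p.2
  change (p : EuclideanSpace ℝ (Fin m)) ∈ Q.carrier.extremePoints ℝ at hpe
  rw [Q.carrier_eq] at hpe
  rw [finrank_top, finrank_euclideanSpace_fin] at hrank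
  have : Nonempty (Fin Q.f) := ⟨j₀⟩
  obtain ⟨y, i, hflag, hyp, hyW⟩ := H'.exists_flag hpe d ⟨trivial, (hlin _).2 hp⟩ (by omega)
  exact ⟨_, _, hflag.cons hz.nonneg (hz.pos j₀ (Finset.mem_univ _))
    fun k hk => (hlin _).1 (hyW k hk).2, rfl, hyp⟩

theorem convexHull_vertices : convexHull ℝ Q.vertices = Q.carrier := by
  obtain ⟨s, hs⟩ := Q.exists_hull
  have hfin : Q.vertices.Finite :=
    s.finite_toSet.subset (by rw [vertices, hs]; exact extremePoints_convexHull_subset)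
  have h1 := closure_convexHull_extremePoints (s := Q.carrier)
    (hs ▸ s.finite_toSet.isCompact_convexHull ℝ) (hs ▸ convex_convexHull ℝ _)
  rw [← h1]
  exact (hfin.isClosed_convexHull ℝ).closure_eq.symm

/-- An affine function that is positive at a point `z` of the polytope is positive at some vertex of
the smallest face containing `z`. -/
theorem exists_vertex {z : EuclideanSpace ℝ (Fin m)} (hz : z ∈ Q.carrier)
    (g : EuclideanSpace ℝ (Fin m) →ᵃ[ℝ] ℝ) (hg : 0 < g z) :
    ∃ p : Q.vertices, 0 < g p ∧ ∀ i, Q.h i z = 0 → Q.h i p = 0 := by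
  rw [← Q.convexHull_vertices, mem_convexHull_iff_exists_fintype] at hz
  obtain ⟨κ, _, w, x, hw, hw1, hx, rfl⟩ := hz
  have hsum : ∀ f : EuclideanSpace ℝ (Fin m) →ᵃ[ℝ] ℝ, f (∑ i, w i • x i) = ∑ i, w i * f (x i) := by
    intro f
    rw [← Finset.affineCombination_eq_linear_combination _ _ _ hw1,
      Finset.map_affineCombination _ _ _ hw1,
      Finset.affineCombination_eq_linear_combination _ _ _ hw1]
    simp
  rw [hsum] at hg
  obtain ⟨k, -, hk⟩ := Finset.exists_lt_of_sum_lt (s := Finset.univ) (f := fun _ : κ => (0 : ℝ))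
    (g := fun i => w i * g (x i)) (by simpa using hg)
  have hwk : 0 < w k := lt_of_le_of_ne (hw k) fun h0 => by simp [← h0] at hk
  refine ⟨⟨x k, hx k⟩, pos_of_mul_pos_right hk hwk.le, fun i hi => ?_⟩
  rw [hsum, Finset.sum_eq_zero_iff_of_nonneg
    fun l _ => mul_nonneg (hw l) (Q.vertex_nonneg ⟨x l, hx l⟩ i)] at hi
  exact (mul_eq_zero.1 (hi k (Finset.mem_univ k))).resolve_left hwk.ne'

end FullDimPolytope

end Polytope

/-! ### Perturbation and rank of positive semidefinite matrices. -/

section PosSemidef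

open Matrix

open scoped MatrixOrder

variable {κ : Type*} [Fintype κ]

theorem Matrix.IsHermitian.mulVec_dotProduct_comm {D : Matrix κ κ ℝ} (hD : D.IsHermitian)
    (v w : κ → ℝ) : v ⬝ᵥ D *ᵥ w = w ⬝ᵥ D *ᵥ v := by
  have hT : Dᵀ = D := by simpa [Matrix.IsHermitian] using hD
  rw [dotProduct_mulVec, ← mulVec_transpose, hT, dotProduct_comm]

theorem Matrix.PosSemidef.dotProduct_nonneg {Y : Matrix κ κ ℝ} (hY : Y.PosSemidef) (v : κ → ℝ) :
    0 ≤ v ⬝ᵥ Y *ᵥ v := by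
  simpa using hY.dotProduct_mulVec_nonneg v

theorem Matrix.PosSemidef.dotProduct_eq_zero_iff {Y : Matrix κ κ ℝ} (hY : Y.PosSemidef)
    (v : κ → ℝ) : v ⬝ᵥ Y *ᵥ v = 0 ↔ Y *ᵥ v = 0 := by
  simpa using hY.dotProduct_mulVec_zero_iff v

theorem Matrix.PosSemidef.dotProduct_pos {Y : Matrix κ κ ℝ} (hY : Y.PosSemidef) {v : κ → ℝ}
    (hv : Y *ᵥ v ≠ 0) : 0 < v ⬝ᵥ Y *ᵥ v :=
  lt_of_le_of_ne (hY.dotProduct_nonneg v) fun h => hv ((hY.dotProduct_eq_zero_iff v).1 h.symm)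

theorem Matrix.exists_dotProduct_mulVec_le (E : Matrix κ κ ℝ) :
    ∃ c : ℝ, 0 < c ∧ ∀ w : κ → ℝ, |w ⬝ᵥ E *ᵥ w| ≤ c * (w ⬝ᵥ w) := by
  refine ⟨∑ i, ∑ j, |E i j| + 1, by positivity, fun w => ?_⟩
  have hww : 0 ≤ w ⬝ᵥ w := Finset.sum_nonneg fun i _ => mul_self_nonneg _
  have hle : ∀ i, w i * w i ≤ w ⬝ᵥ w := fun i =>
    Finset.single_le_sum (f := fun i => w i * w i) (fun i _ => mul_self_nonneg _)
      (Finset.mem_univ i)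
  have h1 : w ⬝ᵥ E *ᵥ w = ∑ i, ∑ j, w i * (E i j * w j) := by
    simp only [dotProduct, mulVec, Finset.mul_sum]
  calc |w ⬝ᵥ E *ᵥ w| ≤ ∑ i, ∑ j, |w i * (E i j * w j)| := by
        rw [h1]
        exact (Finset.abs_sum_le_sum_abs _ _).trans
          (Finset.sum_le_sum fun i _ => Finset.abs_sum_le_sum_abs _ _)
    _ ≤ ∑ i, ∑ j, |E i j| * (w ⬝ᵥ w) := by
        refine Finset.sum_le_sum fun i _ => Finset.sum_le_sum fun j _ => ?_
        have : |w i * (E i j * w j)| = |E i j| * |w i * w j| := by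
          rw [← abs_mul]; congr 1; ring
        rw [this]
        gcongr
        rw [abs_le]
        constructor <;> nlinarith [hle i, hle j, sq_nonneg (w i + w j), sq_nonneg (w i - w j)]
    _ = (∑ i, ∑ j, |E i j|) * (w ⬝ᵥ w) := by simp only [Finset.sum_mul]
    _ ≤ _ := by gcongr; linarith

theorem LinearMap.exists_generalized_inverse {K V W : Type*} [Field K] [AddCommGroup V] [Module K V]
    [AddCommGroup W] [Module K W] (f : V →ₗ[K] W) : ∃ g : W →ₗ[K] V, ∀ v, f (g (f v)) = f v := by
  obtain ⟨g, hg⟩ := f.rangeRestrict.exists_rightInverse_of_surjective f.range_rangeRestrict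
  obtain ⟨g', hg'⟩ := LinearMap.exists_extend g
  refine ⟨g', fun v => ?_⟩
  have h1 : g' (f v) = g (f.rangeRestrict v) := LinearMap.congr_fun hg' (f.rangeRestrict v)
  have h2 := LinearMap.congr_fun hg (f.rangeRestrict v)
  rw [h1]
  exact congrArg Subtype.val h2

/-- A positive semidefinite matrix stays positive semidefinite under small symmetric perturbations
that vanish on its kernel. -/
theorem Matrix.PosSemidef.exists_perturb {Y D : Matrix κ κ ℝ} (hY : Y.PosSemidef)
    (hD : D.IsHermitian) (hker : ∀ v, Y *ᵥ v = 0 → D *ᵥ v = 0) :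
    ∃ ε : ℝ, 0 < ε ∧ (Y + ε • D).PosSemidef := by
  classical
  obtain ⟨S, hS⟩ : ∃ S : Matrix κ κ ℝ, Y = Sᵀ * S := by
    obtain ⟨S, hS⟩ := CStarAlgebra.nonneg_iff_eq_star_mul_self.1 hY.nonneg
    exact ⟨S, by simpa [star_eq_conjTranspose] using hS⟩
  obtain ⟨g, hg⟩ := S.mulVecLin.exists_generalized_inverse
  set G := LinearMap.toMatrix' g with hG
  have hgG : ∀ v, g v = G *ᵥ v := fun v => by rw [hG, ← Matrix.toLin'_apply]; simp
  have hYS : ∀ v, v ⬝ᵥ Y *ᵥ v = (S *ᵥ v) ⬝ᵥ (S *ᵥ v) := fun v => by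
    rw [hS, ← mulVec_mulVec, dotProduct_mulVec, vecMul_transpose]
  -- `D` vanishes on `ker S ⊆ ker Y`, so its quadratic form factors through `S`; it is then bounded
  -- by a multiple of `‖S v‖² = vᵀ Y v`.
  have hDG : ∀ v, v ⬝ᵥ D *ᵥ v = (S *ᵥ v) ⬝ᵥ (Gᵀ * D * G) *ᵥ (S *ᵥ v) := by
    intro v
    have h1 : D *ᵥ (v - g (S *ᵥ v)) = 0 := by
      refine hker _ ?_
      have := hg v
      simp only [mulVecLin_apply] at this
      rw [hS, ← mulVec_mulVec, mulVec_sub, this, sub_self, mulVec_zero]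
    rw [mulVec_sub, sub_eq_zero] at h1
    rw [← mulVec_mulVec, ← mulVec_mulVec, dotProduct_mulVec (S *ᵥ v), vecMul_transpose, ← hgG,
      h1, hD.mulVec_dotProduct_comm v, h1]
  obtain ⟨c, hc, hcw⟩ := (Gᵀ * D * G).exists_dotProduct_mulVec_le
  refine ⟨c⁻¹, inv_pos.2 hc, PosSemidef.of_dotProduct_mulVec_nonneg
    (hY.isHermitian.add ?_) fun v => ?_⟩
  · rw [IsHermitian, conjTranspose_smul, hD.eq]; simp
  · rw [star_trivial, add_mulVec, smul_mulVec, dotProduct_add, dotProduct_smul, hYS, hDG,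
      smul_eq_mul]
    have h1 := neg_le_of_abs_le (hcw (S *ᵥ v))
    have h2 := mul_le_mul_of_nonneg_left h1 (inv_pos.2 hc).le
    rw [mul_neg, inv_mul_cancel_left₀ hc.ne'] at h2
    linarith

theorem Matrix.vecMulVec_self_mulVec (u v : κ → ℝ) : vecMulVec u u *ᵥ v = (u ⬝ᵥ v) • u := by
  rw [vecMulVec_mulVec]; simp

/-- If the kernel of a positive semidefinite matrix is spanned by `b`, then it stays positive
semidefinite under small symmetric perturbations that are positive at `b`. -/
theorem Matrix.PosSemidef.exists_perturb_of_ker {Y D : Matrix κ κ ℝ} (hY : Y.PosSemidef)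
    (hD : D.IsHermitian) {b : κ → ℝ} (hker : ∀ v, Y *ᵥ v = 0 → ∃ c : ℝ, v = c • b)
    (hb : 0 < b ⬝ᵥ D *ᵥ b) :
    ∃ ε : ℝ, 0 < ε ∧ (Y + ε • D).PosSemidef := by
  set β := b ⬝ᵥ D *ᵥ b with hβ
  -- The rank-one matrix `R` agrees with `D` at `b`, so `D - R` vanishes on the kernel of `Y`, and
  -- adding `R` back preserves semidefiniteness.
  set R := β⁻¹ • vecMulVec (D *ᵥ b) (D *ᵥ b) with hR
  have hRpsd : R.PosSemidef :=
    (by simpa using posSemidef_vecMulVec_self_star (D *ᵥ b) :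
      (vecMulVec (D *ᵥ b) (D *ᵥ b)).PosSemidef).smul (inv_pos.2 hb).le
  obtain ⟨ε, hε, h⟩ := hY.exists_perturb (hD.sub hRpsd.isHermitian) (fun v hv => by
    obtain ⟨c, rfl⟩ := hker v hv
    rw [mulVec_smul, sub_mulVec, hR, smul_mulVec, vecMulVec_self_mulVec, dotProduct_comm, ← hβ,
      smul_smul, inv_mul_cancel₀ hb.ne', one_smul, sub_self, smul_zero])
  refine ⟨ε, hε, ?_⟩
  have h2 := h.add (hRpsd.smul hε.le)
  rwa [add_assoc, ← smul_add, sub_add_cancel] at h2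

/-- A nonzero positive semidefinite matrix whose kernel has codimension at most one is of the form
`a aᵀ`. -/
theorem Matrix.PosSemidef.exists_eq_vecMulVec {A : Matrix κ κ ℝ} (hA : A.PosSemidef)
    (hker : Fintype.card κ ≤ Module.finrank ℝ (LinearMap.ker A.mulVecLin) + 1) :
    ∃ a : κ → ℝ, A = vecMulVec a a := by
  classical
  by_cases h0 : ∀ u, A *ᵥ u = 0
  · refine ⟨0, ?_⟩
    rw [vecMulVec_zero]
    exact Matrix.ext_of_mulVec_single fun i => by rw [h0, zero_mulVec]
  push Not at h0
  obtain ⟨u, hu⟩ := h0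
  have hc := hA.dotProduct_pos hu
  set c := u ⬝ᵥ A *ᵥ u with hcdef
  have hlt : LinearMap.ker A.mulVecLin < LinearMap.ker A.mulVecLin ⊔ Submodule.span ℝ {u} := by
    refine lt_of_le_of_ne le_sup_left fun h => hu ?_
    have : u ∈ LinearMap.ker A.mulVecLin := by
      rw [h]
      exact Submodule.mem_sup_right (Submodule.mem_span_singleton_self u)
    simpa using this
  have htop : LinearMap.ker A.mulVecLin ⊔ Submodule.span ℝ {u} = ⊤ := by
    apply Submodule.eq_top_of_finrank_eq
    have h1 := Submodule.finrank_lt_finrank_of_lt hlt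
    have h2 := Submodule.finrank_le (LinearMap.ker A.mulVecLin ⊔ Submodule.span ℝ {u})
    rw [Module.finrank_fintype_fun_eq_card] at h2 ⊢
    omega
  have hcs : (√c)⁻¹ * (√c)⁻¹ = c⁻¹ := by
    rw [← mul_inv, Real.mul_self_sqrt hc.le]
  -- The kernel and `u` span the space, so it is enough to match `A` on both; this forces the scale
  -- `√(uᵀ A u)`.
  refine ⟨(√c)⁻¹ • A *ᵥ u, ?_⟩
  refine Matrix.ext_of_mulVec_single fun i => ?_
  have hi : Pi.single i (1 : ℝ) ∈ LinearMap.ker A.mulVecLin ⊔ Submodule.span ℝ {u} := by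
    rw [htop]; trivial
  obtain ⟨w, hw, x, hx, hwx⟩ := Submodule.mem_sup.1 hi
  obtain ⟨t, rfl⟩ := Submodule.mem_span_singleton.1 hx
  have hw : A *ᵥ w = 0 := by simpa using hw
  rw [← hwx, vecMulVec_self_mulVec, mulVec_add, hw, zero_add, mulVec_smul, smul_dotProduct,
    dotProduct_add, dotProduct_comm _ w, hA.isHermitian.mulVec_dotProduct_comm, hw, dotProduct_zero,
    dotProduct_smul, dotProduct_comm _ u, ← hcdef, smul_smul, smul_eq_mul, smul_eq_mul, zero_add]
  congr 1
  calc t = c⁻¹ * c * t := by rw [inv_mul_cancel₀ hc.ne', one_mul]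
    _ = _ := by rw [← hcs]; ring

end PosSemidef

/-! ### Kernels and supporting functions on spectrahedra. -/

theorem AffineMap.apply_add {V : Type*} [AddCommGroup V] [Module ℝ V] (g : V →ᵃ[ℝ] ℝ) (x v : V) :
    g (x + v) = g x + g.linear v := by
  have h1 := g.map_vadd x v
  simp only [vadd_eq_add] at h1
  rw [add_comm, h1, add_comm]

theorem AffineMap.linear_sub {V : Type*} [AddCommGroup V] [Module ℝ V] (g : V →ᵃ[ℝ] ℝ) (x y : V) :
    g.linear (x - y) = g x - g y :=
  g.linearMap_vsub x y

section Spectrahedron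

open Matrix

variable {κ ι : Type*} [Fintype κ] {L : AffineSubspace ℝ (Matrix κ κ ℝ)}

theorem AffineSubspace.add_smul_sub_mem {V : Type*} [AddCommGroup V] [Module ℝ V]
    {L : AffineSubspace ℝ V} {x y z : V} (hz : z ∈ L) (hx : x ∈ L) (hy : y ∈ L) (t : ℝ) :
    z + t • (x - y) ∈ L := by
  have := L.smul_vsub_vadd_mem t hx hy hz
  rwa [vadd_eq_add, vsub_eq_sub, add_comm] at this

/-- A point of a spectrahedron outside the face supported by `g` has a kernel that does not contain
the kernel of a point of this face. -/
theorem exists_mulVec_ne_zero {g : Matrix κ κ ℝ →ᵃ[ℝ] ℝ}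
    (hg : ∀ X ∈ L, X.PosSemidef → 0 ≤ g X) {X Y : Matrix κ κ ℝ} (hXL : X ∈ L) (hX : X.PosSemidef)
    (hYL : Y ∈ L) (hY : Y.PosSemidef) (hgX : 0 < g X) (hgY : g Y = 0) :
    ∃ v, Y *ᵥ v = 0 ∧ X *ᵥ v ≠ 0 := by
  by_contra! hcon
  -- Otherwise the line from `X` to `Y` could be prolonged beyond `Y` within the slice, where `g` is
  -- negative.
  obtain ⟨ε, hε, h⟩ := hY.exists_perturb (hY.isHermitian.sub hX.isHermitian)
    fun v hv => by rw [sub_mulVec, hv, hcon v hv, sub_zero]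
  have := hg _ (AffineSubspace.add_smul_sub_mem hYL hYL hXL ε) h
  rw [AffineMap.apply_add, map_smul, AffineMap.linear_sub, hgY, smul_eq_mul] at this
  nlinarith

theorem Matrix.PosSemidef.ker_half_add {X Y : Matrix κ κ ℝ} (hX : X.PosSemidef)
    (hY : Y.PosSemidef) (v : κ → ℝ) :
    (Y + (1 / 2 : ℝ) • (X - Y)) *ᵥ v = 0 ↔ X *ᵥ v = 0 ∧ Y *ᵥ v = 0 := by
  have hxy : Y + (1 / 2 : ℝ) • (X - Y) = (1 / 2 : ℝ) • (X + Y) := by module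
  rw [hxy, smul_mulVec, smul_eq_zero_iff_right (by norm_num), ← (hX.add hY).dotProduct_eq_zero_iff,
    add_mulVec, dotProduct_add, ← hX.dotProduct_eq_zero_iff, ← hY.dotProduct_eq_zero_iff]
  have h1 := hX.dotProduct_nonneg v
  have h2 := hY.dotProduct_nonneg v
  constructor
  · intro h; constructor <;> linarith
  · rintro ⟨h3, h4⟩; linarith

/-- The kernels of generic points in the faces of a flag of a spectrahedron increase strictly. -/
theorem IsFlag.exists_finrank_ker_add_le {g : ι → Matrix κ κ ℝ →ᵃ[ℝ] ℝ}
    (hg : ∀ X ∈ L, X.PosSemidef → ∀ i, 0 ≤ g i X) (d : ℕ) :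
    ∀ {X : ℕ → Matrix κ κ ℝ} {j : ℕ → ι}, IsFlag g d X j →
      (∀ k ≤ d, X k ∈ L ∧ (X k).PosSemidef) →
      ∃ Y ∈ L, Y.PosSemidef ∧ (∀ i, (∀ k ≤ d, g i (X k) = 0) → g i Y = 0) ∧
        Module.finrank ℝ (LinearMap.ker Y.mulVecLin) + d ≤
          Module.finrank ℝ (LinearMap.ker (X d).mulVecLin) := by
  induction d with
  | zero =>
    intro X j _ hX
    exact ⟨X 0, (hX 0 le_rfl).1, (hX 0 le_rfl).2, fun i hi => hi 0 le_rfl, le_rfl⟩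
  | succ d ih =>
    intro X j hflag hX
    obtain ⟨Y, hYL, hY, hYg, hrank⟩ := ih hflag.tail fun k hk => hX (k + 1) (by omega)
    have hX0 := hX 0 (Nat.zero_le _)
    have hxy : Y + (1 / 2 : ℝ) • (X 0 - Y) = (1 / 2 : ℝ) • (X 0 + Y) := by module
    refine ⟨Y + (1 / 2 : ℝ) • (X 0 - Y), AffineSubspace.add_smul_sub_mem hYL hX0.1 hYL _, ?_,
      fun i hi => ?_, ?_⟩
    · rw [hxy]; exact (hX0.2.add hY).smul (by norm_num)
    · rw [AffineMap.apply_add, map_smul, AffineMap.linear_sub,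
        hYg i fun k hk => hi (k + 1) (by omega), hi 0 (Nat.zero_le _)]
      simp
    · have hlt : LinearMap.ker (Y + (1 / 2 : ℝ) • (X 0 - Y)).mulVecLin <
          LinearMap.ker Y.mulVecLin := by
        refine lt_of_le_of_ne (fun v hv => ?_) fun h => ?_
        · simp only [LinearMap.mem_ker, mulVecLin_apply] at hv ⊢
          exact ((hX0.2.ker_half_add hY v).1 hv).2
        · obtain ⟨v, hv, hv'⟩ := exists_mulVec_ne_zero (fun X hXL hX => hg X hXL hX (j 0))
            hX0.1 hX0.2 hYL hY (hflag.pos 0 (Nat.succ_pos d))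
            (hYg _ fun k hk => hflag.zero 0 (k + 1) (Nat.succ_pos k) (by omega))
          have hv1 : v ∈ LinearMap.ker Y.mulVecLin := by simpa using hv
          rw [← h, LinearMap.mem_ker, mulVecLin_apply] at hv1
          exact hv' ((hX0.2.ker_half_add hY v).1 hv1).1
      have := Submodule.finrank_lt_finrank_of_lt hlt
      omega

/-- An affine function that is nonnegative on a spectrahedron and vanishes at a point whose kernel is
spanned by `b` is proportional to `A ↦ bᵀ A b`. -/
theorem apply_mul_eq_of_ker {g : Matrix κ κ ℝ →ᵃ[ℝ] ℝ}
    (hg : ∀ X ∈ L, X.PosSemidef → 0 ≤ g X) {A X Y : Matrix κ κ ℝ} (hAL : A ∈ L) (hA : A.PosSemidef)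
    (hXL : X ∈ L) (hX : X.PosSemidef) (hYL : Y ∈ L) (hY : Y.PosSemidef) (hgY : g Y = 0)
    {b : κ → ℝ} (hker : ∀ v, Y *ᵥ v = 0 → ∃ c : ℝ, v = c • b) (hYb : Y *ᵥ b = 0)
    (hXb : 0 < b ⬝ᵥ X *ᵥ b) :
    g A = g X / (b ⬝ᵥ X *ᵥ b) * (b ⬝ᵥ A *ᵥ b) := by
  -- Moving from `Y` in the direction `s (A - Y) + t (X - Y)` stays in the cone when its form is
  -- positive at `b`. This makes one linear functional of `(s, t)` nonnegative wherever the other is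
  -- positive, so the two are proportional.
  have key : ∀ s t : ℝ, 0 < s * (b ⬝ᵥ A *ᵥ b) + t * (b ⬝ᵥ X *ᵥ b) → 0 ≤ s * g A + t * g X := by
    intro s t hst
    have hherm : ∀ (r : ℝ) (B : Matrix κ κ ℝ), B.PosSemidef → (r • (B - Y)).IsHermitian := by
      intro r B hB
      rw [IsHermitian, conjTranspose_smul, (hB.isHermitian.sub hY.isHermitian).eq, star_trivial]
    obtain ⟨ε, hε, h⟩ := hY.exists_perturb_of_ker ((hherm s A hA).add (hherm t X hX)) hker (by
      rw [add_mulVec, smul_mulVec, smul_mulVec, sub_mulVec, sub_mulVec, hYb, sub_zero, sub_zero,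
        dotProduct_add, dotProduct_smul, dotProduct_smul]
      exact hst)
    have hmem : Y + ε • (s • (A - Y) + t • (X - Y)) ∈ L := by
      rw [smul_add, smul_smul, smul_smul, ← add_assoc]
      exact AffineSubspace.add_smul_sub_mem (AffineSubspace.add_smul_sub_mem hYL hAL hYL _) hXL hYL _
    have h1 := hg _ hmem h
    rw [AffineMap.apply_add, map_smul, map_add, map_smul, map_smul, AffineMap.linear_sub,
      AffineMap.linear_sub, hgY, sub_zero, sub_zero, zero_add] at h1
    exact nonneg_of_mul_nonneg_right h1 hε
  set β := b ⬝ᵥ X *ᵥ b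
  set α := b ⬝ᵥ A *ᵥ b
  have hgX := hg X hXL hX
  have h1 : ∀ δ > 0, 0 ≤ g A + (δ - α / β) * g X := fun δ hδ => by
    have := key 1 (δ - α / β) (by rw [sub_mul, div_mul_cancel₀ _ hXb.ne']; nlinarith)
    rwa [one_mul] at this
  have h2 : ∀ δ > 0, 0 ≤ - g A + (δ + α / β) * g X := fun δ hδ => by
    have := key (-1) (δ + α / β) (by rw [add_mul, div_mul_cancel₀ _ hXb.ne']; nlinarith)
    rwa [neg_one_mul] at this
  have heq : g X / β * α = α / β * g X := by ring
  rw [heq]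
  have hlim : ∀ u : ℝ, (∀ δ > 0, u ≤ δ * g X) → u ≤ 0 := by
    intro u hu
    refine le_of_forall_pos_le_add fun η hη => ?_
    -- The `+ 1` keeps the denominator positive even if `g X = 0`.
    have h3 := hu (η / (g X + 1)) (by positivity)
    have h4 : η / (g X + 1) * g X ≤ η := by
      rw [div_mul_eq_mul_div, div_le_iff₀ (by positivity)]
      nlinarith
    linarith
  refine le_antisymm (sub_nonpos.1 (hlim _ fun δ hδ => ?_)) (sub_nonpos.1 (hlim _ fun δ hδ => ?_))
  · linarith [h2 δ hδ, add_mul δ (α / β) (g X)]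
  · linarith [h1 δ hδ, sub_mul δ (α / β) (g X)]

end Spectrahedron

/-! ### From a psd lift to a Hadamard square root. -/

namespace FullDimPolytope

open Matrix

variable {m : ℕ} (Q : FullDimPolytope m)

theorem isBounded : Bornology.IsBounded Q.carrier := by
  obtain ⟨s, hs⟩ := Q.exists_hull
  rw [hs]
  exact (s.finite_toSet.isCompact_convexHull ℝ).isBounded

theorem exists_vertex_of_facet (j : Fin Q.f) : ∃ p : Q.vertices, Q.h j p = 0 := by
  classical
  obtain ⟨z, hz, hirr⟩ := Q.exists_isFaceFrame
  obtain ⟨z', -, hz'j, H', -⟩ := hz.step (Finset.mem_univ j) (by convert hirr j)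
  obtain ⟨p, -, hp⟩ := Q.exists_vertex (z := z') (by rw [Q.carrier_eq]; exact H'.nonneg)
    (AffineMap.const ℝ _ 1) (by simp)
  exact ⟨p, hp j hz'j⟩

/-- An affine slice of the psd cone that is mapped to a polytope of positive dimension does not
contain the origin. -/
theorem zero_notMem_of_eq_image [NeZero m] {κ : Type*} [Fintype κ]
    {L : AffineSubspace ℝ (Matrix κ κ ℝ)} {π : Matrix κ κ ℝ →ₗ[ℝ] EuclideanSpace ℝ (Fin m)}
    (hC : Q.carrier = π '' ({X | X.PosSemidef} ∩ (L : Set (Matrix κ κ ℝ)))) : 0 ∉ L := by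
  intro h0
  have hsub : Q.carrier ⊆ {0} := by
    intro x hx
    -- With `0 ∈ L` the slice is closed under nonnegative scaling, so its bounded image is at most a
    -- point.
    have hmul : ∀ n : ℕ, (n : ℝ) • x ∈ Q.carrier := by
      intro n
      rw [hC] at hx ⊢
      obtain ⟨X, ⟨hX, hXL⟩, rfl⟩ := hx
      refine ⟨(n : ℝ) • X, ⟨hX.smul (Nat.cast_nonneg n), ?_⟩, map_smul _ _ _⟩
      simpa using AffineSubspace.add_smul_sub_mem h0 hXL h0 n
    obtain ⟨R, hR⟩ := Q.isBounded.exists_norm_le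
    by_contra hne
    have hpos : 0 < ‖x‖ := norm_pos_iff.2 hne
    obtain ⟨n, hn⟩ := exists_nat_gt (R / ‖x‖)
    have h1 := hR _ (hmul n)
    rw [norm_smul, Real.norm_natCast] at h1
    rw [div_lt_iff₀ hpos] at hn
    linarith
  have : Nonempty (Fin m) := ⟨0⟩
  have : (nhdsWithin (0 : EuclideanSpace ℝ (Fin m)) {0}ᶜ).NeBot :=
    Module.punctured_nhds_neBot ℝ _ 0
  have h1 := Q.fullDim.mono (interior_mono hsub)
  rw [interior_singleton] at h1
  exact h1.ne_empty rfl

/-- If an `m`-polytope has a psd lift of size `m + 1`, then its slack matrix has a Hadamard square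
root of rank at most `m + 1`. -/
theorem exists_hadamard_sqrt [NeZero m] (hQ : HasPsdLift Q.carrier (m + 1)) :
    ∃ (a : Q.vertices → Fin (m + 1) → ℝ) (b : Fin Q.f → Fin (m + 1) → ℝ),
      ∀ (p : Q.vertices) j, Q.h j p = (b j ⬝ᵥ a p) ^ 2 := by
  obtain ⟨d, hd⟩ : ∃ d, m = d + 1 := ⟨m - 1, by have := NeZero.pos m; omega⟩
  obtain ⟨L, π, hC⟩ := hQ
  have hlift : ∀ x, ∃ X, x ∈ Q.carrier → X ∈ L ∧ X.PosSemidef ∧ π X = x := by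
    intro x
    by_cases hx : x ∈ Q.carrier
    · rw [hC] at hx
      obtain ⟨X, ⟨hX, hXL⟩, rfl⟩ := hx
      exact ⟨X, fun _ => ⟨hXL, hX, rfl⟩⟩
    · exact ⟨0, fun h => absurd h hx⟩
  choose σ hσ using hlift
  set g : Fin Q.f → Matrix (Fin (m + 1)) (Fin (m + 1)) ℝ →ᵃ[ℝ] ℝ :=
    fun i => (Q.h i).comp π.toAffineMap with hgdef
  have hgσ : ∀ x ∈ Q.carrier, ∀ i, g i (σ x) = Q.h i x := fun x hx i => by
    simp [hgdef, (hσ x hx).2.2]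
  have hg : ∀ X ∈ L, X.PosSemidef → ∀ i, 0 ≤ g i X := by
    intro X hXL hX i
    have : π X ∈ Q.carrier := by rw [hC]; exact ⟨X, ⟨hX, hXL⟩, rfl⟩
    rw [Q.carrier_eq] at this
    exact this i
  have hflagσ : ∀ {y j}, IsFlag Q.h (d + 1) y j → IsFlag g (d + 1) (fun k => σ (y k)) j ∧
      ∀ k ≤ d + 1, σ (y k) ∈ L ∧ (σ (y k)).PosSemidef := by
    intro y j H
    have hy : ∀ k ≤ d + 1, y k ∈ Q.carrier := fun k hk => by
      rw [Q.carrier_eq]; exact H.nonneg k hk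
    refine ⟨⟨fun k hk i => ?_, fun k hk => ?_, fun i k hik hk => ?_⟩,
      fun k hk => ⟨(hσ _ (hy k hk)).1, (hσ _ (hy k hk)).2.1⟩⟩
    · rw [hgσ _ (hy k hk)]; exact H.nonneg k hk i
    · rw [hgσ _ (hy k hk.le)]; exact H.pos k hk
    · rw [hgσ _ (hy k hk)]; exact H.zero i k hik hk
  have hrow : ∀ p : Q.vertices, ∃ a : Fin (m + 1) → ℝ, σ p = vecMulVec a a := by
    intro p
    obtain ⟨j, hj⟩ := Q.exists_facet_of_vertex p
    obtain ⟨y, i, hflag, -, hyp⟩ := Q.exists_flag hd p hj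
    obtain ⟨hF, hX⟩ := hflagσ hflag
    obtain ⟨Y, -, -, -, hY⟩ := hF.exists_finrank_ker_add_le hg _ hX
    refine (hσ p p.2.1).2.1.exists_eq_vecMulVec ?_
    change _ + _ ≤ Module.finrank ℝ (LinearMap.ker (σ (y (d + 1))).mulVecLin) at hY
    rw [hyp] at hY
    rw [Fintype.card_fin]
    omega
  choose a ha using hrow
  have hcol : ∀ j, ∃ b : Fin (m + 1) → ℝ, ∀ p : Q.vertices, Q.h j p = (b ⬝ᵥ a p) ^ 2 := by
    intro j
    obtain ⟨p, hp⟩ := Q.exists_vertex_of_facet j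
    obtain ⟨y, i, hflag, hi, hyp⟩ := Q.exists_flag hd p hp
    obtain ⟨hF, hX⟩ := hflagσ hflag
    obtain ⟨Y, hYL, hY, hYg, hYrank⟩ :=
      hF.tail.exists_finrank_ker_add_le hg _ fun k hk => hX (k + 1) (by omega)
    have hgY : g j Y = 0 := hYg j fun k hk => by
      rw [← hi]; exact hF.zero 0 (k + 1) (Nat.succ_pos k) (by omega)
    have hgX : 0 < g j (σ (y 0)) := by
      rw [← hi]; exact hF.pos 0 (Nat.succ_pos d)
    obtain ⟨hXL, hX⟩ := hX 0 (Nat.zero_le _)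
    have hgj : ∀ X ∈ L, X.PosSemidef → 0 ≤ g j X := fun X hXL hX => hg X hXL hX j
    obtain ⟨b, hYb, hXb⟩ := exists_mulVec_ne_zero hgj hXL hX hYL hY hgX hgY
    have hb : b ≠ 0 := by rintro rfl; simp at hXb
    -- The flag without its top point has `d = m - 1` steps down to `p`, and `σ p ≠ 0` has kernel of
    -- dimension at most `m`.
    have hrank : Module.finrank ℝ (LinearMap.ker Y.mulVecLin) ≤ 1 := by
      have hne : LinearMap.ker (σ p).mulVecLin ≠ ⊤ := by
        intro h
        refine Q.zero_notMem_of_eq_image hC ?_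
        have h0 : σ p = 0 := by
          refine Matrix.ext_of_mulVec_single fun k => ?_
          have : Pi.single k (1 : ℝ) ∈ LinearMap.ker (σ p).mulVecLin := by rw [h]; trivial
          rw [LinearMap.mem_ker, mulVecLin_apply] at this
          rw [this, zero_mulVec]
        rw [← h0]
        exact (hσ p p.2.1).1
      have h1 := Submodule.finrank_lt hne
      rw [Module.finrank_fintype_fun_eq_card, Fintype.card_fin] at h1
      change _ + _ ≤ Module.finrank ℝ (LinearMap.ker (σ (y (d + 1))).mulVecLin) at hYrank
      rw [hyp] at hYrank
      omega
    have hker : ∀ v, Y *ᵥ v = 0 → ∃ c : ℝ, v = c • b := by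
      intro v hv
      obtain ⟨w, hw⟩ := finrank_le_one_iff.1 hrank
      obtain ⟨s, hs⟩ := hw ⟨b, by simpa using hYb⟩
      obtain ⟨t, ht⟩ := hw ⟨v, by simpa using hv⟩
      have hs' : s • (w : Fin (m + 1) → ℝ) = b := congrArg Subtype.val hs
      have ht' : t • (w : Fin (m + 1) → ℝ) = v := congrArg Subtype.val ht
      have hs0 : s ≠ 0 := by rintro rfl; simp at hs'; exact hb hs'.symm
      exact ⟨t * s⁻¹, by rw [← hs', smul_smul, inv_mul_cancel_right₀ hs0, ht']⟩
    have hpos := hX.dotProduct_pos hXb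
    set lam := g j (σ (y 0)) / (b ⬝ᵥ σ (y 0) *ᵥ b) with hlam
    have hlam0 : 0 ≤ lam := by positivity
    refine ⟨√lam • b, fun q => ?_⟩
    obtain ⟨hAL, hA, -⟩ := hσ q q.2.1
    rw [← hgσ q q.2.1, apply_mul_eq_of_ker hgj hAL hA hXL hX hYL hY hgY hker hYb hpos, ← hlam,
      ha q, vecMulVec_self_mulVec, dotProduct_smul, smul_dotProduct, smul_eq_mul, smul_eq_mul,
      mul_pow, Real.sq_sqrt hlam0, dotProduct_comm (a q) b, sq]
  choose b hb using hcol
  exact ⟨a, b, fun p j => hb j p⟩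

end FullDimPolytope

/-! ### Vanishing determinants and trinomials. -/

theorem Matrix.det_eq_zero_of_finrank_lt {N : ℕ} {V : Type*} [AddCommGroup V] [Module ℝ V]
    [FiniteDimensional ℝ V] (u : Fin N → V) (φ : Fin N → V →ₗ[ℝ] ℝ)
    (hN : Module.finrank ℝ V < N) : (Matrix.of fun i j => φ j (u i)).det = 0 := by
  have : ¬ LinearIndependent ℝ u := fun h => by
    have := h.fintype_card_le_finrank
    rw [Fintype.card_fin] at this
    omega
  obtain ⟨c, hc, i, hi⟩ := Fintype.not_linearIndependent_iff.1 this
  refine Matrix.exists_vecMul_eq_zero_iff.1 ⟨c, fun h => hi (by rw [h]; rfl), funext fun j => ?_⟩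
  have := congrArg (φ j) hc
  simpa [Matrix.vecMul, dotProduct] using this

/-- With equal signs the sum of squares vanishes. Otherwise one number is the sum of the other two,
and the square relation says that twice the product of those two is zero. -/
theorem eq_zero_of_signed_sums {α β γ A B C : ℝ} (hα : α = 1 ∨ α = -1) (hβ : β = 1 ∨ β = -1)
    (hγ : γ = 1 ∨ γ = -1) (h : α * A + β * B + γ * C = 0)
    (h2 : α * A ^ 2 + β * B ^ 2 + γ * C ^ 2 = 0) : A = 0 ∨ B = 0 ∨ C = 0 := by
  have key : A * B * C = 0 := by
    rcases hα with rfl | rfl <;> rcases hβ with rfl | rfl <;> rcases hγ with rfl | rfl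
    · have : A = 0 := by nlinarith [sq_nonneg A, sq_nonneg B, sq_nonneg C]
      simp [this]
    · have : C = A + B := by linarith
      subst this; linear_combination (-(A + B) / 2) * h2
    · have : B = A + C := by linarith
      subst this; linear_combination (-(A + C) / 2) * h2
    · have : A = B + C := by linarith
      subst this; linear_combination ((B + C) / 2) * h2
    · have : A = B + C := by linarith
      subst this; linear_combination (-(B + C) / 2) * h2
    · have : B = A + C := by linarith
      subst this; linear_combination ((A + C) / 2) * h2
    · have : C = A + B := by linarith
      subst this; linear_combination ((A + B) / 2) * h2
    · have : A = 0 := by nlinarith [sq_nonneg A, sq_nonneg B, sq_nonneg C]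
      simp [this]
  rcases mul_eq_zero.1 key with h | h
  · rcases mul_eq_zero.1 h with h | h <;> simp [h]
  · simp [h]

/-- A trinomial cannot vanish both at a point with nonzero coordinates and at the point with the
squared coordinates. -/
theorem IsTrinomial.eval_ne_zero {σ : Type*} {D : MvPolynomial σ ℝ} (hD : IsTrinomial D)
    {x : σ → ℝ} (hx : ∀ i, x i ≠ 0) (h : MvPolynomial.eval x D = 0) :
    MvPolynomial.eval (fun i => x i ^ 2) D ≠ 0 := by
  obtain ⟨a, b, c, α, β, γ, -, -, -, hα, hβ, hγ, rfl⟩ := hD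
  intro h2
  have hsq : ∀ e : σ →₀ ℕ, (e.prod fun i k => (x i ^ 2) ^ k) = (e.prod fun i k => x i ^ k) ^ 2 := by
    intro e
    rw [Finsupp.prod, Finsupp.prod, ← Finset.prod_pow]
    exact Finset.prod_congr rfl fun i _ => by ring
  have hne : ∀ e : σ →₀ ℕ, (e.prod fun i k => x i ^ k) ≠ 0 := fun e =>
    Finset.prod_ne_zero_iff.2 fun i _ => pow_ne_zero _ (hx i)
  simp only [map_add, MvPolynomial.eval_monomial, hsq] at h h2
  rcases eq_zero_of_signed_sums hα hβ hγ h h2 with h | h | h <;> exact hne _ h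

theorem hasPsdLift_of_psdRank_eq {n k : ℕ} {C : Set (EuclideanSpace ℝ (Fin n))}
    (h : psdRank C = k) : HasPsdLift C k := by
  have hlt : psdRank C < (k : ℕ∞) + 1 := by
    rw [h]; exact_mod_cast Nat.lt_succ_self k
  rw [psdRank, iInf_lt_iff] at hlt
  obtain ⟨l, hl⟩ := hlt
  rw [iInf_lt_iff] at hl
  obtain ⟨hmem, hl⟩ := hl
  have h1 : psdRank C ≤ l := iInf₂_le l hmem
  rw [h] at h1
  have h2 : k ≤ l := by exact_mod_cast h1
  have h3 : l < k + 1 := by exact_mod_cast hl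
  obtain rfl : l = k := by omega
  exact hmem.2

/-! ### Dimension and slack rank under combinatorial equivalence. -/

namespace FullDimPolytope

variable {n m : ℕ}

theorem isEmpty_facets (Q : FullDimPolytope 0) : IsEmpty (Fin Q.f) := by
  refine ⟨fun j => Q.irredundant j ?_⟩
  obtain ⟨z, hz⟩ := Q.fullDim
  have hz := interior_subset hz
  have huniv : Q.carrier = Set.univ := Set.eq_univ_of_forall fun x => by
    rwa [Subsingleton.elim x z]
  rw [huniv, eq_comm]
  refine Set.eq_univ_of_forall fun x i _ => ?_
  have : x ∈ Q.carrier := by rw [huniv]; trivial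
  rw [Q.carrier_eq] at this
  exact this i

/-- A complete flag of `Q` yields `m + 1` vertices with a triangular incidence pattern against `m`
facets. The pattern transfers to `P` and makes the corresponding vertices affinely independent. -/
theorem CombEquiv.dim_le {P : FullDimPolytope n} {Q : FullDimPolytope m} (h : P.CombEquiv Q) :
    m ≤ n := by
  rcases Nat.eq_zero_or_pos m with rfl | hm
  · exact Nat.zero_le n
  obtain ⟨φ, ψ, hφψ⟩ := h
  have : NeZero m := ⟨hm.ne'⟩
  obtain ⟨d, hd⟩ : ∃ d, m = d + 1 := ⟨m - 1, by omega⟩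
  obtain ⟨z, hz, -⟩ := Q.exists_isFaceFrame
  obtain ⟨q₀, -⟩ := Q.exists_vertex (z := z) (by rw [Q.carrier_eq]; exact hz.nonneg)
    (AffineMap.const ℝ _ 1) (by simp)
  obtain ⟨j₀, hj₀⟩ := Q.exists_facet_of_vertex q₀
  obtain ⟨y, j, hflag, -, -⟩ := Q.exists_flag hd q₀ hj₀
  have hy : ∀ k ≤ d + 1, y k ∈ Q.carrier := fun k hk => by
    rw [Q.carrier_eq]; exact hflag.nonneg k hk
  have hP : ∀ (p : P.vertices) i, P.h i p = 0 ↔ Q.h (ψ i) (φ p) = 0 := fun p i => by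
    rw [← mem_facet_iff, ← mem_facet_iff]; exact hφψ p i
  have hv : ∀ k : Fin (d + 1), ∃ p : P.vertices, P.h (ψ.symm (j k)) p ≠ 0 ∧
      ∀ i < (k : ℕ), P.h (ψ.symm (j i)) p = 0 := by
    intro k
    obtain ⟨q, hq, hq'⟩ := Q.exists_vertex (hy k k.2.le) (Q.h (j k)) (hflag.pos k k.2)
    refine ⟨φ.symm q, ?_, fun i hi => ?_⟩
    · rw [ne_eq, hP]; simpa using hq.ne'
    · rw [hP]; simpa using hq' _ (hflag.zero i k hi k.2.le)
  obtain ⟨p₀, hp₀⟩ : ∃ p : P.vertices, ∀ i < d + 1, P.h (ψ.symm (j i)) p = 0 := by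
    obtain ⟨q, -, hq'⟩ := Q.exists_vertex (hy (d + 1) le_rfl) (AffineMap.const ℝ _ 1) (by simp)
    refine ⟨φ.symm q, fun i hi => ?_⟩
    rw [hP]; simpa using hq' _ (hflag.zero i (d + 1) hi le_rfl)
  choose p hp hp' using hv
  have hind : LinearIndependent ℝ fun k => (p k : EuclideanSpace ℝ (Fin n)) - p₀ := by
    rw [Fintype.linearIndependent_iff]
    intro c hc
    have hstep : ∀ k : ℕ, ∀ hk : k < d + 1, c ⟨k, hk⟩ = 0 := by
      intro k
      induction k using Nat.strong_induction_on with
      | _ k ih =>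
        intro hk
        -- The `k`-th facet function kills the terms after `k`; those before `k` vanish by
        -- induction.
        have h1 := congrArg (P.h (ψ.symm (j k))).linear hc
        rw [map_sum, map_zero, Finset.sum_eq_single ⟨k, hk⟩] at h1
        · rw [map_smul, AffineMap.linear_sub, hp₀ k hk, sub_zero, smul_eq_mul] at h1
          exact (mul_eq_zero.1 h1).resolve_right (hp ⟨k, hk⟩)
        · intro l _ hl
          rw [map_smul, AffineMap.linear_sub, hp₀ k hk, sub_zero]
          rcases lt_trichotomy (l : ℕ) k with hlt | heq | hgt
          · rw [show c l = 0 from ih l hlt l.2, zero_smul]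
          · exact absurd (Fin.ext heq) hl
          · rw [hp' l k hgt, smul_zero]
        · simp
    exact fun k => hstep k k.2
  have := hind.fintype_card_le_finrank
  rw [Fintype.card_fin, finrank_euclideanSpace_fin] at this
  omega

/-- Homogenizing each vertex to `(1, p)` makes slack entries linear forms on a space of dimension `m
+ 1`. -/
theorem det_slackMatrix_submatrix (Q : FullDimPolytope m) {N : ℕ} (hN : m + 1 < N)
    (r : Fin N → Q.vertices) (c : Fin N → Fin Q.f) : (Q.slackMatrix.submatrix r c).det = 0 := by
  have h := Matrix.det_eq_zero_of_finrank_lt (N := N) (V := ℝ × EuclideanSpace ℝ (Fin m))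
    (fun i => (1, r i))
    (fun j => (LinearMap.toSpanSingleton ℝ ℝ (Q.h (c j) 0)).coprod (Q.h (c j)).linear)
    (by rw [Module.finrank_prod, Module.finrank_self, finrank_euclideanSpace_fin]; omega)
  rw [← h]
  congr 1
  ext i j
  have := (Q.h (c j)).apply_add 0 (r i)
  rw [zero_add] at this
  simp [slackMatrix, this]

end FullDimPolytope

/-! ### The obstruction. -/

theorem lemma5p6 {n m : ℕ} (P : FullDimPolytope n)
    (hP : ∃ D, IsMinor P.symbolicSlackMatrix (n + 2) D ∧ IsTrinomial D)
    (Q : FullDimPolytope m) (hPQ : P.CombEquiv Q) :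
    ¬ Q.PsdMinimal := by
  intro hmin
  have hmn := hPQ.dim_le
  obtain ⟨D, ⟨r, c, rfl⟩, hD⟩ := hP
  obtain ⟨φ, ψ, hφψ⟩ := hPQ
  have hm : NeZero m := ⟨by
    rintro rfl
    exact Q.isEmpty_facets.elim (ψ (c 0))⟩
  obtain ⟨a, b, hab⟩ := Q.exists_hadamard_sqrt
    (hasPsdLift_of_psdRank_eq (by rw [hmin]; exact_mod_cast rfl))
  have hsupp : ∀ p j, 0 < P.slackMatrix p j ↔ Q.h (ψ j) (φ p) ≠ 0 := by
    intro p j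
    have h1 := hφψ p j
    rw [FullDimPolytope.mem_facet_iff, FullDimPolytope.mem_facet_iff] at h1
    rw [ne_eq, ← h1]
    exact ⟨fun h => ne_of_gt h, fun h => lt_of_le_of_ne (P.vertex_nonneg p j) (Ne.symm h)⟩
  classical
  -- The value `1` at positions whose variable does not occur in the symbolic matrix only serves to
  -- make every coordinate nonzero.
  set x : P.vertices × Fin P.f → ℝ := fun e =>
    if 0 < P.slackMatrix e.1 e.2 then b (ψ e.2) ⬝ᵥ a (φ e.1) else 1 with hx
  have hx0 : ∀ e, x e ≠ 0 := by
    intro e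
    simp only [hx]
    split_ifs with h
    · intro h0
      rw [hsupp, hab, h0] at h
      simp at h
    · exact one_ne_zero
  have heval : ∀ (w : P.vertices × Fin P.f → ℝ) (M : Q.vertices → Fin Q.f → ℝ),
      (∀ p j, 0 < P.slackMatrix p j → w (p, j) = M (φ p) (ψ j)) →
      (∀ p j, ¬ 0 < P.slackMatrix p j → M (φ p) (ψ j) = 0) →
      MvPolynomial.eval w (P.symbolicSlackMatrix.submatrix r c).det =
        (Matrix.of fun i j => M (φ (r i)) (ψ (c j))).det := by
    intro w M h1 h2
    rw [RingHom.map_det]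
    congr 1
    ext i j
    simp only [RingHom.mapMatrix_apply, Matrix.map_apply, Matrix.submatrix_apply, Matrix.of_apply,
      FullDimPolytope.symbolicSlackMatrix]
    split_ifs with h
    · rw [MvPolynomial.eval_X, h1 _ _ h]
    · rw [map_zero, h2 _ _ h]
  refine hD.eval_ne_zero hx0 ?_ ?_
  · rw [heval x (fun q j => b j ⬝ᵥ a q) (fun p j h => by simp only [hx, if_pos h]) fun p j h => by
      rw [hsupp, not_not, hab] at h
      exact pow_eq_zero_iff two_ne_zero |>.1 h]
    exact Matrix.det_eq_zero_of_finrank_lt (fun i => a (φ (r i)))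
      (fun j => dotProductBilin ℝ ℝ (b (ψ (c j)))) (by simp; omega)
  · rw [heval _ (fun q j => Q.h j q) (fun p j h => by simp only [hx, if_pos h, hab]) fun p j h => by
      rwa [hsupp, not_not] at h]
    exact Q.det_slackMatrix_submatrix (by omega) (fun i => φ (r i)) (fun j => ψ (c j))
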